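/- Let $\alpha=(\sqrt5-1)/2$, let $g(x)=\cot(\pi x)$, let $S_m=\sum_{k=1}^{m} g(k\alpha)$ be the Birkhoff sums of $g$ over the rotation by $\alpha$ with starting point $\theta=0$ (so $S_0=0$), let $q_n$ be the $n$-th Fibonacci number ($q_1=q_2=1$, $q_{n+2}=q_{n+1}+q_n$), and put $s_n(x)=S_{[q_n x]}/q_n$ for $x\in[0,1]$, where $[\cdot]$ denotes the integer part. Then for every $x\in[0,1]$ the limits $s_{\rm even}(x)=\lim_{n\to\infty}s_{2n}(x)$ and $s_{\rm odd}(x)=\lim_{n\to\infty}s_{2n+1}(x)$ exist. Moreover $s_{\rm even}$ has a limit from the right at every $x\in[0,1)$, and this limit equals $s_{\rm even}(x)$ unless $x=a+b\alpha$ with integers $a,b$ and $b\ge 1$. Let $s$ (the "golden graph") be the right-continuous version of $s_{\rm even}$, that is, $s(x)=\lim_{y\downarrow x}s_{\rm even}(y)$ for $x\in[0,1)$ and $s(1)=s_{\rm even}(1)$; thus $s=s_{\rm even}$ on $[0,1]$ except possibly at the countably many points $a+b\alpha$ with $b\ge1$. Then $s$ is continuous from the right on $[0,1)$ and self-similar: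 $s(\alpha x)=-\alpha\, s(x)$ for all $x\in[0,1]$. -/

import Mathlib

open Filter Topology

namespace GoldenGraph

/-- The rotation number: the golden mean `α = (√5 - 1) / 2`. -/
noncomputable def alpha : ℝ := (Real.sqrt 5 - 1) / 2

/-- The observable `g(x) = cot (π x)`. -/
noncomputable def g (x : ℝ) : ℝ := Real.cot (Real.pi * x)

/-- The Birkhoff sum `S_m = ∑_{k=1}^m g(θ + k α)` with starting point `θ`. -/
noncomputable def S (θ : ℝ) (m : ℕ) : ℝ := ∑ k ∈ Finset.Icc 1 m, g (θ + (k : ℝ) * alpha)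

/-- The rescaled Birkhoff function `s_n(x) = S_{[q_n x]} / q_n` for the starting point `θ = 0`,
where `q_n` is the `n`-th Fibonacci number (`q_1 = q_2 = 1`) and `[·]` is the integer part. -/
noncomputable def sFun (n : ℕ) (x : ℝ) : ℝ :=
  S 0 ⌊(Nat.fib n : ℝ) * x⌋₊ / (Nat.fib n : ℝ)

end GoldenGraph

/-! Every pair (k, l) of integers is k α - l = (-α)^n (a α - b) for a unique (a, b), because -α is a
unit of ℤ[α]. Then k = q_n (a φ + b) + a (-α)^n, so k / q_n tends to the conjugate quantity a φ + b,
while cot(π k α) / q_n tends to ± √5 / (π (a α - b)), the sign being the parity of n. Thus the even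
limit is formally the sum of √5 / (π (a α - b)) over 0 < a φ + b ≤ x, up to boundary terms with a φ
+ b = x. Multiplication by the unit turns a φ + b into α (a φ + b) and each term into -α times
itself, which is the self-similarity.

The series is only formal, so each cotangent is split at height φ^(n-j) into a truncated part and an
excess. The truncated part is bounded, monotone on a period and odd: Denjoy–Koksma on a greedy
Fibonacci decomposition (`abs_sum_clamp_le_sum`) makes its contribution at most `err j`, uniformly
in x. The excess involves finitely many lattice points (`sum_excess_eq`) and converges termwise.
Since `err j` tends to 0, the limits in n and in y ↓ x pass through (`exists_tendsto_of_approx`),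
and the exact scaling `headRight_alpha_mul` passes to the limit. -/

namespace GoldenGraph

/-! ### Golden ratio and Fibonacci numbers -/

/-- The golden ratio `φ = 1 + α = 1 / α`. -/
noncomputable def phi : ℝ := 1 + alpha

lemma alpha_pos : 0 < alpha := by
  have : (1 : ℝ) < Real.sqrt 5 := by
    rw [Real.lt_sqrt] <;> norm_num
  unfold alpha; linarith

lemma alpha_sq : alpha ^ 2 = 1 - alpha := by
  have : Real.sqrt 5 ^ 2 = 5 := Real.sq_sqrt (by norm_num)
  unfold alpha; linarith

lemma alpha_lt_one : alpha < 1 := by nlinarith [alpha_pos, alpha_sq]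

lemma sqrt_five_eq : Real.sqrt 5 = 2 * alpha + 1 := by unfold alpha; ring

lemma phi_pos : 0 < phi := by unfold phi; linarith [alpha_pos]

lemma one_lt_phi : 1 < phi := by unfold phi; linarith [alpha_pos]

lemma phi_lt_two : phi < 2 := by unfold phi; linarith [alpha_lt_one]

lemma phi_sq : phi ^ 2 = phi + 1 := by unfold phi; linarith [alpha_sq]

lemma phi_mul_alpha : phi * alpha = 1 := by unfold phi; linarith [alpha_sq]

lemma phi_pow_mul_alpha_pow (n : ℕ) : phi ^ n * alpha ^ n = 1 := by
  rw [← mul_pow, phi_mul_alpha, one_pow]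

lemma inv_phi_pow (n : ℕ) : (phi ^ n)⁻¹ = alpha ^ n :=
  inv_eq_of_mul_eq_one_right (phi_pow_mul_alpha_pow n)

lemma irrational_alpha : Irrational alpha := by
  have h : Irrational (Real.sqrt 5) := by
    have := Nat.Prime.irrational_sqrt (p := 5) (by norm_num)
    simpa using this
  unfold alpha
  have := (h.sub_intCast 1).div_natCast (m := 2) (by norm_num)
  simpa using this

lemma int_combination_eq_zero {a b : ℤ} (h : (a : ℝ) * alpha + b = 0) : a = 0 ∧ b = 0 := by
  have ha : a = 0 := by
    by_contra ha
    apply ((irrational_alpha.intCast_mul ha).add_intCast b).ne_zero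
    exact h
  subst ha
  simpa using h

lemma fib_succ_eq (n : ℕ) : (Nat.fib (n + 1) : ℝ) = phi * Nat.fib n + (-alpha) ^ n := by
  induction n with
  | zero => simp
  | succ n ih =>
    have h : phi * ((-alpha) ^ n) - (-alpha) ^ (n + 1) = (phi + alpha) * (-alpha) ^ n := by ring
    rw [Nat.fib_add_two, Nat.cast_add, pow_succ]
    have h2 : (Nat.fib n : ℝ) = alpha * (Nat.fib (n + 1) - (-alpha) ^ n) := by
      rw [ih]; linear_combination (-(Nat.fib n : ℝ)) * phi_mul_alpha
    rw [h2]
    unfold phi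
    ring

lemma sqrt_five_mul_fib (n : ℕ) :
    Real.sqrt 5 * Nat.fib n = phi ^ n - (-alpha) ^ n := by
  rw [sqrt_five_eq]
  induction n with
  | zero => simp
  | succ n ih =>
    rw [fib_succ_eq, pow_succ, pow_succ]
    have : phi = 1 + alpha := rfl
    linear_combination phi * ih - (-alpha) ^ n * this

lemma fib_le_phi_pow (n : ℕ) : (Nat.fib n : ℝ) ≤ phi ^ n := by
  induction n using Nat.twoStepInduction with
  | zero => simp
  | one => simpa using one_lt_phi.le
  | more n h1 h2 =>
    rw [Nat.fib_add_two, Nat.cast_add, pow_add, phi_sq]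
    rw [pow_succ] at h2
    linarith

lemma phi_pow_le_fib (n : ℕ) : phi ^ n ≤ 3 * Nat.fib (n + 1) := by
  induction n using Nat.twoStepInduction with
  | zero => norm_num
  | one => norm_num; linarith [phi_lt_two]
  | more n h1 h2 =>
    rw [Nat.fib_add_two, Nat.cast_add, pow_add, phi_sq]
    rw [pow_succ] at h2
    linarith

lemma fib_mul_alpha_pow_le (n : ℕ) : (Nat.fib n : ℝ) * alpha ^ n ≤ 1 := by
  have := mul_le_mul_of_nonneg_right (fib_le_phi_pow n) (pow_nonneg alpha_pos.le n)
  rwa [phi_pow_mul_alpha_pow] at this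

/-! ### Renormalised coordinates on ℤ[α] -/

/-- Multiplication by `(-α) ^ n` in `ℤ[α]`, in coordinates: first coordinate. -/
def kCoord (n : ℕ) (p : ℤ × ℤ) : ℤ := p.1 * Nat.fib (n + 1) + p.2 * Nat.fib n

/-- Multiplication by `(-α) ^ n` in `ℤ[α]`, in coordinates: second coordinate. -/
def lCoord (n : ℕ) (p : ℤ × ℤ) : ℤ :=
  p.1 * Nat.fib n + p.2 * (Nat.fib (n + 1) - Nat.fib n)

/-- The element `a α - b` of `ℤ[α]`. -/
noncomputable def elt (p : ℤ × ℤ) : ℝ := p.1 * alpha - p.2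

/-- Minus the conjugate of `elt`, that is `a φ + b`. -/
noncomputable def conj (p : ℤ × ℤ) : ℝ := p.1 * phi + p.2

lemma kCoord_mul_alpha_sub (n : ℕ) (p : ℤ × ℤ) :
    (kCoord n p : ℝ) * alpha - lCoord n p = (-alpha) ^ n * elt p := by
  unfold kCoord lCoord elt
  push_cast
  rw [fib_succ_eq]
  unfold phi
  linear_combination (p.1 : ℝ) * Nat.fib n * alpha_sq

/-- After division by q_n only `conj p` survives; the sign of the small remainder decides on which
side of q_n x the index falls when `conj p = x`. -/
lemma kCoord_eq (n : ℕ) (p : ℤ × ℤ) :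
    (kCoord n p : ℝ) = Nat.fib n * conj p + p.1 * (-alpha) ^ n := by
  unfold kCoord conj
  push_cast
  rw [fib_succ_eq]
  ring

lemma sqrt_five_mul_fst (p : ℤ × ℤ) : Real.sqrt 5 * p.1 = elt p + conj p := by
  rw [sqrt_five_eq]; unfold elt conj phi; ring

lemma kCoord_eq' (n : ℕ) (p : ℤ × ℤ) :
    (kCoord n p : ℝ) = p.1 * phi ^ n - Nat.fib n * elt p := by
  rw [kCoord_eq]
  linear_combination (p.1 : ℝ) * sqrt_five_mul_fib n - (Nat.fib n : ℝ) * sqrt_five_mul_fst p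

/-- Since -α is a unit, the coordinate change is invertible over ℤ; each induction step divides by
-α once more. -/
lemma exists_coord (n : ℕ) (k l : ℤ) : ∃ p, kCoord n p = k ∧ lCoord n p = l := by
  induction n with
  | zero => exact ⟨(k, l), by simp [kCoord, lCoord]⟩
  | succ n ih =>
    obtain ⟨⟨a, b⟩, h1, h2⟩ := ih
    refine ⟨(b, a - b), ?_, ?_⟩
    · rw [← h1]; simp only [kCoord, Nat.fib_add_two]; push_cast; ring
    · rw [← h2]; simp only [lCoord, Nat.fib_add_two]; push_cast; ring

lemma coord_injective (n : ℕ) {p p' : ℤ × ℤ} (hk : kCoord n p = kCoord n p')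
    (hl : lCoord n p = lCoord n p') : p = p' := by
  have h1 := kCoord_mul_alpha_sub n p
  have h2 := kCoord_mul_alpha_sub n p'
  rw [hk, hl, h2] at h1
  have h3 : elt p' = elt p := mul_left_cancel₀ (pow_ne_zero n (neg_ne_zero.2 alpha_pos.ne')) h1
  have h4 := int_combination_eq_zero (a := p.1 - p'.1) (b := p'.2 - p.2) (by
    push_cast; unfold elt at h3; linarith)
  exact Prod.ext (by linarith [h4.1]) (by linarith [h4.2])

/-- Best approximation: `|k α - l| ≥ α ^ n` for `1 ≤ k < q_{n+1}`. -/
lemma alpha_pow_le_abs_sub (n : ℕ) (k l : ℤ) (hk : 1 ≤ k) (hk' : k < Nat.fib (n + 1)) :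
    alpha ^ n ≤ |(k : ℝ) * alpha - l| := by
  obtain ⟨⟨a, b⟩, h1, h2⟩ := exists_coord n k l
  rw [← h1, ← h2, kCoord_mul_alpha_sub, abs_mul, abs_pow, abs_neg, abs_of_pos alpha_pos]
  refine le_mul_of_one_le_right (pow_nonneg alpha_pos.le n) ?_
  simp only [kCoord] at h1
  have hF : (0 : ℤ) ≤ Nat.fib n := by positivity
  have hF' : (0 : ℤ) ≤ Nat.fib (n + 1) := by positivity
  have hb : b ≠ 0 := by
    rintro rfl
    have : 0 < a := by nlinarith
    nlinarith
  unfold elt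
  simp only
  -- The range of k forces a and b to have opposite signs (or a = 0), so the terms of a α - b add up
  -- and |b| ≥ 1 suffices.
  rcases lt_or_gt_of_ne hb with hb | hb
  · have ha : 0 ≤ a := by
      by_contra! h
      nlinarith
    have ha : (0 : ℝ) ≤ a := by exact_mod_cast ha
    have hb : (b : ℝ) ≤ -1 := by exact_mod_cast (by omega : b ≤ -1)
    exact le_trans (by nlinarith [alpha_pos]) (le_abs_self _)
  · have ha : a ≤ 0 := by
      by_contra! h
      nlinarith
    have ha : (a : ℝ) ≤ 0 := by exact_mod_cast ha
    have hb : (1 : ℝ) ≤ b := by exact_mod_cast hb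
    exact le_trans (by nlinarith [alpha_pos]) (neg_le_abs _)

/-! ### Truncation and bounds for the cotangent -/

/-- Truncation of `c` to the interval `[-M, M]`. -/
noncomputable def clamp (M c : ℝ) : ℝ := max (-M) (min M c)

lemma clamp_mono (M : ℝ) : Monotone (clamp M) := fun _ _ h =>
  max_le_max le_rfl (min_le_min le_rfl h)

lemma abs_clamp_le {M : ℝ} (hM : 0 ≤ M) (c : ℝ) : |clamp M c| ≤ M :=
  abs_le.2 ⟨le_max_left _ _, max_le (by linarith) (min_le_left _ _)⟩

lemma clamp_neg {M : ℝ} (hM : 0 ≤ M) (c : ℝ) : clamp M (-c) = -clamp M c := by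
  unfold clamp
  rcases le_total M c with h | h <;> rcases le_total (-M) c with h' | h' <;>
    rcases le_total M (-c) with h'' | h'' <;> simp [*] <;> linarith

lemma clamp_of_abs_le {M c : ℝ} (h : |c| ≤ M) : clamp M c = c := by
  have := abs_le.1 h
  rw [clamp, min_eq_right this.2, max_eq_right this.1]

/-- Lets an a priori bound on the values lower the truncation height, and with it the Denjoy–Koksma
constant. -/
lemma clamp_eq_clamp_min {M K c : ℝ} (h : |c| ≤ K) : clamp M c = clamp (min M K) c := by
  rcases le_total M K with h' | h'
  · rw [min_eq_left h']
  · rw [min_eq_right h', clamp_of_abs_le h, clamp_of_abs_le (h.trans h')]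

lemma clamp_mul {M c t : ℝ} (ht : 0 ≤ t) : clamp (t * M) (t * c) = t * clamp M c := by
  unfold clamp
  rw [mul_max_of_nonneg _ _ ht, mul_min_of_nonneg _ _ ht, mul_neg]

lemma g_add_int (x : ℝ) (n : ℤ) : g (x + n) = g x := by
  unfold g
  rw [Real.cot_eq_cos_div_sin, Real.cot_eq_cos_div_sin, mul_add, mul_comm Real.pi (n : ℝ),
    Real.sin_add_int_mul_pi, Real.cos_add_int_mul_pi, mul_div_mul_left]
  exact zpow_ne_zero _ (by norm_num)

lemma g_neg (x : ℝ) : g (-x) = -g x := by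
  unfold g
  rw [Real.cot_eq_cos_div_sin, Real.cot_eq_cos_div_sin, mul_neg, Real.cos_neg, Real.sin_neg,
    div_neg]

lemma g_eq_tan (x : ℝ) : g x = Real.tan (Real.pi / 2 - Real.pi * x) := by
  rw [Real.tan_pi_div_two_sub, g, ← Real.cot_inv_eq_tan, inv_inv]

lemma g_antitoneOn : AntitoneOn g (Set.Ioo 0 1) := by
  intro x hx y hy h
  have hpi := Real.pi_pos
  rw [g_eq_tan, g_eq_tan]
  apply Real.strictMonoOn_tan.monotoneOn
  · constructor <;> nlinarith [hy.1, hy.2]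
  · constructor <;> nlinarith [hx.1, hx.2]
  · nlinarith

lemma abs_g_le_of_pos {x : ℝ} (h0 : 0 < x) (h : x ≤ 1 / 2) : |g x| ≤ 1 / x := by
  have hpi := Real.pi_pos
  have h3 := Real.pi_gt_three
  rw [g, ← inv_inv (Real.cot _), Real.cot_inv_eq_tan]
  -- At 1/2 the tangent has default value 0, whose inverse 0 is the true cotangent.
  rcases h.eq_or_lt with rfl | h
  · rw [show Real.pi * (1 / 2) = Real.pi / 2 by ring, Real.tan_pi_div_two]
    norm_num
  · have h1 : Real.pi * x < Real.tan (Real.pi * x) := Real.lt_tan (by positivity) (by nlinarith)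
    have h2 : 0 < Real.pi * x := by positivity
    rw [abs_of_pos (inv_pos.2 (h2.trans h1)), ← one_div]
    exact one_div_le_one_div_of_le h0 (by nlinarith)

lemma abs_g_le {x : ℝ} (h0 : x ≠ 0) (h : |x| ≤ 1 / 2) : |g x| ≤ 1 / |x| := by
  rcases lt_or_gt_of_ne h0 with h' | h'
  · rw [abs_of_neg h'] at *
    rw [← abs_neg, ← g_neg]
    exact abs_g_le_of_pos (by linarith) h
  · rw [abs_of_pos h'] at *
    exact abs_g_le_of_pos h' h

lemma g_sub_round (x : ℝ) : g (x - round x) = g x := by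
  have := g_add_int (x - round x) (round x)
  rwa [sub_add_cancel, eq_comm] at this

lemma abs_g_le_of_dist {x d : ℝ} (hd : 0 < d) (h : ∀ l : ℤ, d ≤ |x - l|) : |g x| ≤ 1 / d := by
  rw [← g_sub_round]
  have h1 := h (round x)
  have h2 : x - round x ≠ 0 := abs_pos.1 (hd.trans_le h1)
  exact (abs_g_le h2 (abs_sub_round x)).trans (one_div_le_one_div_of_le hd h1)

/-! ### Denjoy–Koksma estimates -/

lemma sum_grid_eq_zero {f : ℝ → ℝ} (hper : ∀ (x : ℝ) (n : ℤ), f (x + n) = f x)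
    (hodd : ∀ x, f (-x) = -f x) (q : ℕ) :
    ∑ j ∈ Finset.range q, f ((j : ℝ) / q) = 0 := by
  rcases q with _ | q
  · simp
  have h0 : f 0 = 0 := by have := hodd 0; simp at this; linarith
  rw [Finset.sum_range_succ']
  have hr := Finset.sum_range_reflect (fun j : ℕ => f (((j + 1 : ℕ) : ℝ) / (q + 1 : ℕ))) q
  have : ∑ j ∈ Finset.range q, f (((q - 1 - j + 1 : ℕ) : ℝ) / (q + 1 : ℕ)) =
      -∑ j ∈ Finset.range q, f (((j + 1 : ℕ) : ℝ) / (q + 1 : ℕ)) := by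
    rw [← Finset.sum_neg_distrib]
    refine Finset.sum_congr rfl fun j hj => ?_
    have hj := Finset.mem_range.1 hj
    rw [← hodd, ← hper (-_) 1]
    congr 1
    rw [show q - 1 - j + 1 = q - j by omega, Nat.cast_sub hj.le]
    push_cast
    field_simp
    ring
  simp only [Nat.cast_zero, zero_div, h0, add_zero]
  linarith

/-- One-sided Denjoy–Koksma estimate for points lying one in each cell of a grid. -/
lemma sum_perturbed_grid_le {f : ℝ → ℝ} {M : ℝ} (hper : ∀ (x : ℝ) (n : ℤ), f (x + n) = f x)
    (hodd : ∀ x, f (-x) = -f x) (hanti : AntitoneOn f (Set.Ioo 0 1)) (hM : ∀ x, |f x| ≤ M)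
    {q : ℕ} (hq : 0 < q) {p : ℤ} (hp : IsCoprime (q : ℤ) p) (θ : ℝ) {e : ℕ → ℝ}
    (he : ∀ k < q, 0 ≤ e k ∧ e k ≤ 1 / q) :
    ∑ k ∈ Finset.range q, f (θ + k * (p / q) + e k) ≤ 4 * M := by
  have hq' : (0 : ℝ) < q := by exact_mod_cast hq
  have hM0 : 0 ≤ M := (abs_nonneg _).trans (hM 0)
  set j₀ : ℤ := ⌊q * θ⌋ with hj₀
  set σ : ℕ → ℕ := fun k => ((j₀ + k * p) % q).toNat with hσ
  have hσ' : ∀ k, (σ k : ℤ) = (j₀ + k * p) % q := fun k =>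
    Int.toNat_of_nonneg (Int.emod_nonneg _ (by omega))
  have hlt : ∀ k, σ k < q := fun k => by
    have := Int.emod_lt_of_pos (j₀ + k * p) (by omega : (0 : ℤ) < q)
    rw [← hσ'] at this
    exact_mod_cast this
  -- A point of cell j lies in [j/q, (j+2)/q), so monotonicity bounds f there by f(j/q). This fails
  -- only at j = 0, where the jump sits, and at j = q - 1, where the point may pass 1; each costs
  -- 2M.
  set U : ℕ → ℝ := fun j => f ((j : ℝ) / q) + (if j = 0 then 2 * M else 0) +
    (if j = q - 1 then 2 * M else 0) with hU
  have hle : ∀ k ∈ Finset.range q, f (θ + k * (p / q) + e k) ≤ U (σ k) := by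
    intro k hk
    obtain ⟨he0, he1⟩ := he k (Finset.mem_range.1 hk)
    have hdiv := Int.emod_add_mul_ediv (j₀ + k * p) q
    rw [← hσ'] at hdiv
    have hdiv' : ((σ k : ℕ) : ℝ) + q * (((j₀ + k * p) / q : ℤ) : ℝ) = j₀ + k * p := by
      exact_mod_cast hdiv
    set d : ℤ := (j₀ + k * p) / q
    obtain ⟨u, hfl, hf0, hf1⟩ : ∃ u : ℝ, j₀ + u = q * θ ∧ 0 ≤ u ∧ u < 1 :=
      ⟨_, Int.floor_add_fract _, Int.fract_nonneg _, Int.fract_lt_one _⟩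
    set t : ℝ := (σ k : ℝ) / q + u / q + e k with ht
    have hpt : θ + k * (p / q) + e k = t + d := by
      rw [ht, ← mul_right_inj' hq'.ne']
      have : (q : ℝ) * (θ + k * (p / q) + e k) = q * θ + k * p + q * e k := by
        field_simp
      rw [this]
      field_simp
      linarith
    rw [hpt, hper]
    have b1 := abs_le.1 (hM t)
    have b2 := abs_le.1 (hM ((σ k : ℝ) / q))
    simp only [hU]
    by_cases h0 : σ k = 0
    · rw [if_pos h0]; split_ifs <;> linarith
    by_cases h1 : σ k = q - 1
    · rw [if_neg h0, if_pos h1]; linarith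
    rw [if_neg h0, if_neg h1, add_zero, add_zero]
    have hs2 : ((σ k : ℕ) : ℝ) + 2 ≤ q := by
      have := hlt k
      exact_mod_cast (by omega : σ k + 2 ≤ q)
    have hpos : (0 : ℝ) < (σ k : ℝ) / q := by
      have : (0 : ℝ) < (σ k : ℕ) := by exact_mod_cast Nat.pos_of_ne_zero h0
      positivity
    have hge : (σ k : ℝ) / q ≤ t := by
      have : 0 ≤ u / q := by positivity
      linarith
    have hlt1 : t < 1 := by
      have h3 : t ≤ ((σ k : ℝ) + u + 1) / q := by
        rw [ht, add_div, add_div]; linarith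
      refine h3.trans_lt ?_
      rw [div_lt_one hq']
      linarith
    exact hanti ⟨hpos, hge.trans_lt hlt1⟩ ⟨hpos.trans_le hge, hlt1⟩ hge
  have hinj : Set.InjOn σ (Finset.range q) := by
    intro k hk k' hk' h
    have hk := Finset.mem_range.1 hk
    have hk' := Finset.mem_range.1 hk'
    have h1 : (j₀ + k * p) % q = (j₀ + k' * p) % q := by rw [← hσ', ← hσ', h]
    have h2 : (q : ℤ) ∣ (j₀ + k * p) - (j₀ + k' * p) := (Int.ModEq.dvd h1.symm)
    rw [show (j₀ + k * p) - (j₀ + k' * p) = ((k : ℤ) - k') * p by ring] at h2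
    have h3 := hp.dvd_of_dvd_mul_right h2
    have h4 := Int.eq_zero_of_abs_lt_dvd h3 (by rw [abs_lt]; omega)
    omega
  have himg : (Finset.range q).image σ = Finset.range q := by
    apply Finset.eq_of_subset_of_card_le
    · intro j hj
      obtain ⟨k, -, rfl⟩ := Finset.mem_image.1 hj
      exact Finset.mem_range.2 (hlt k)
    · rw [Finset.card_image_of_injOn hinj]
  calc _ ≤ ∑ k ∈ Finset.range q, U (σ k) := Finset.sum_le_sum hle
    _ = ∑ j ∈ Finset.range q, U j := by
      rw [← Finset.sum_image (f := U) hinj, himg]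
    _ ≤ 4 * M := by
      simp only [hU, Finset.sum_add_distrib, sum_grid_eq_zero hper hodd, Finset.sum_ite_eq',
        Finset.mem_range]
      split_ifs <;> linarith

/-- One-sided Denjoy–Koksma estimate for rotations. -/
lemma sum_rotation_le {f : ℝ → ℝ} {M : ℝ} (hper : ∀ (x : ℝ) (n : ℤ), f (x + n) = f x)
    (hodd : ∀ x, f (-x) = -f x) (hanti : AntitoneOn f (Set.Ioo 0 1)) (hM : ∀ x, |f x| ≤ M)
    {q : ℕ} (hq : 0 < q) {p : ℤ} (hp : IsCoprime (q : ℤ) p) (θ : ℝ) {a : ℝ}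
    (ha : |a * q - p| ≤ 1 / q) :
    ∑ k ∈ Finset.range q, f (θ + k * a) ≤ 4 * M := by
  have hq' : (0 : ℝ) < q := by exact_mod_cast hq
  have hk : ∀ k < q, 0 ≤ (k : ℝ) / q ∧ (k : ℝ) / q ≤ 1 := fun k hk => by
    have : (k : ℝ) ≤ q := by exact_mod_cast hk.le
    exact ⟨by positivity, (div_le_one hq').2 this⟩
  have ha := abs_le.1 ha
  rcases le_total 0 (a * q - p) with h | h
  · have := sum_perturbed_grid_le hper hodd hanti hM hq hp θ (e := fun k => k / q * (a * q - p))
      fun k hk' => ⟨mul_nonneg (hk k hk').1 h,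
        (mul_le_of_le_one_left h (hk k hk').2).trans ha.2⟩
    convert this using 3 with k _
    field_simp
    ring
  -- The drift is now to the left; moving the origin back by 1/q makes the perturbations nonnegative
  -- again.
  · have := sum_perturbed_grid_le hper hodd hanti hM hq hp (θ - 1 / q)
      (e := fun k => 1 / q + k / q * (a * q - p))
      fun k hk' => ⟨by nlinarith [hk k hk'], by nlinarith [hk k hk']⟩
    convert this using 3 with k _
    field_simp
    ring

lemma fib_succ_mul_alpha_sub (s : ℕ) :
    alpha * Nat.fib (s + 1) - Nat.fib s = -(-alpha) ^ (s + 1) := by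
  rw [fib_succ_eq, pow_succ]
  linear_combination (Nat.fib s : ℝ) * phi_mul_alpha

/-- Denjoy–Koksma estimate for the truncated cotangent. -/
lemma abs_sum_clamp_le {M : ℝ} (hM : 0 ≤ M) (s : ℕ) (θ : ℝ) :
    |∑ k ∈ Finset.range (Nat.fib (s + 1)), clamp M (g (θ + k * alpha))| ≤ 4 * M := by
  have hq : 0 < Nat.fib (s + 1) := Nat.fib_pos.2 s.succ_pos
  have hq' : (0 : ℝ) < Nat.fib (s + 1) := by exact_mod_cast hq
  have hper : ∀ (x : ℝ) (n : ℤ), clamp M (g (x + n)) = clamp M (g x) := fun x n => by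
    rw [g_add_int]
  have hodd : ∀ x, clamp M (g (-x)) = -clamp M (g x) := fun x => by rw [g_neg, clamp_neg hM]
  have hanti : AntitoneOn (fun x => clamp M (g x)) (Set.Ioo 0 1) := fun x hx y hy h =>
    clamp_mono M (g_antitoneOn hx hy h)
  have hb : ∀ x, |clamp M (g x)| ≤ M := fun x => abs_clamp_le hM _
  have hcop : IsCoprime (Nat.fib (s + 1) : ℤ) (Nat.fib s : ℤ) :=
    (Nat.isCoprime_iff_coprime.2 (Nat.fib_coprime_fib_succ s)).symm
  have hap : |alpha * Nat.fib (s + 1) - (Nat.fib s : ℤ)| ≤ 1 / Nat.fib (s + 1) := by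
    rw [Int.cast_natCast, fib_succ_mul_alpha_sub, abs_neg, abs_pow, abs_neg,
      abs_of_pos alpha_pos, le_div_iff₀ hq', mul_comm]
    exact fib_mul_alpha_pow_le _
  refine abs_le.2 ⟨?_, sum_rotation_le hper hodd hanti hb hq hcop θ hap⟩
  -- By oddness, the lower bound is the upper bound for the reflected rotation.
  have hap' : |(-alpha) * Nat.fib (s + 1) - ((-Nat.fib s : ℤ) : ℝ)| ≤ 1 / Nat.fib (s + 1) := by
    rw [← abs_neg]; convert hap using 2; push_cast; ring
  have := sum_rotation_le hper hodd hanti hb hq hcop.neg_right (-θ) hap'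
  have h2 : ∀ k : ℕ, clamp M (g (-θ + k * -alpha)) = -clamp M (g (θ + k * alpha)) := fun k => by
    rw [← hodd]; congr 2; ring
  simp only [h2, Finset.sum_neg_distrib] at this
  linarith

/-! ### Truncated Birkhoff sums -/

/-- Bound for truncated Birkhoff sums of length less than `q_n`. -/
lemma abs_sum_clamp_le_sum {M : ℝ} (hM : 0 ≤ M) (n : ℕ) :
    ∀ m < Nat.fib (n + 1), ∀ θ : ℝ, |θ| ≤ alpha ^ (n + 1) →
    |∑ k ∈ Finset.range m, clamp M (g (θ + alpha + k * alpha))| ≤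
      4 * ∑ r ∈ Finset.range n, min M (phi ^ (r + 3)) := by
  have hnn : ∀ r : ℕ, 0 ≤ min M (phi ^ (r + 3)) := fun r =>
    le_min hM (pow_nonneg phi_pos.le _)
  induction n using Nat.strong_induction_on with
  | _ n ih =>
    intro m hm θ hθ
    rcases n with _ | n
    · have : m = 0 := by simpa using hm
      simp [this]
    have ha := alpha_pos
    by_cases hlt : m < Nat.fib (n + 1)
    · refine (ih n n.lt_succ_self m hlt θ (hθ.trans ?_)).trans ?_
      · exact pow_le_pow_of_le_one ha.le alpha_lt_one.le (by omega)
      · rw [Finset.sum_range_succ]; linarith [hnn n]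
    push Not at hlt
    obtain ⟨n, rfl⟩ : ∃ n', n = n' + 1 := Nat.exists_eq_succ_of_ne_zero (by
      rintro rfl
      simp only [zero_add, Nat.fib_one, Nat.reduceAdd, Nat.fib_two] at hm hlt
      omega)
    obtain ⟨m', rfl⟩ := Nat.exists_eq_add_of_le hlt
    -- Greedy decomposition: split off the largest Fibonacci block. Its points stay at distance
    -- α^(n+2) - α^(n+3) = α^(n+4) from ℤ, so the cotangent is at most φ^(n+4) there.
    have hblock : |∑ k ∈ Finset.range (Nat.fib (n + 2)), clamp M (g (θ + alpha + k * alpha))| ≤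
        4 * min M (phi ^ (n + 4)) := by
      have : ∀ k ∈ Finset.range (Nat.fib (n + 2)), clamp M (g (θ + alpha + k * alpha)) =
          clamp (min M (phi ^ (n + 4))) (g (θ + alpha + k * alpha)) := by
        intro k hk
        have hk := Finset.mem_range.1 hk
        apply clamp_eq_clamp_min
        rw [← inv_inv (phi ^ (n + 4)), inv_phi_pow, ← one_div]
        refine abs_g_le_of_dist (pow_pos ha _) fun l => ?_
        have h1 := alpha_pow_le_abs_sub (n + 2) (k + 1) l (by omega) (by
          have : Nat.fib (n + 2) < Nat.fib (n + 2 + 1) := Nat.fib_lt_fib_succ (by omega)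
          omega)
        have h2 : alpha ^ (n + 2) - alpha ^ (n + 3) = alpha ^ (n + 4) := by
          rw [pow_succ _ (n + 3), pow_succ _ (n + 2)]
          linear_combination alpha ^ (n + 2) * alpha_sq * (-1)
        have h3 : ((k : ℤ) + 1 : ℤ) * alpha - l = (θ + alpha + k * alpha - l) - θ := by
          push_cast; ring
        rw [h3] at h1
        have := abs_sub (θ + alpha + k * alpha - l) θ
        linarith
      rw [Finset.sum_congr rfl this]
      exact abs_sum_clamp_le (hnn _) (n + 1) _
    rw [Finset.sum_range_add]
    refine (abs_add_le _ _).trans ?_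
    rw [Finset.sum_range_succ]
    -- The block shifts the origin by ±α^(n+2) modulo 1. The rest has length below F_(n+1), so two
    -- levels are dropped, and α^(n+3) + α^(n+2) = α^(n+1) is exactly the offset allowed there.
    have hrest : |∑ k ∈ Finset.range m',
        clamp M (g (θ + alpha + ((Nat.fib (n + 2) + k : ℕ) : ℝ) * alpha))| ≤
        4 * ∑ r ∈ Finset.range n, min M (phi ^ (r + 3)) := by
      have hm' : m' < Nat.fib (n + 1) := by
        have : Nat.fib (n + 1 + 1 + 1) = Nat.fib (n + 1) + Nat.fib (n + 1 + 1) := Nat.fib_add_two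
        rw [this] at hm
        omega
      have := ih n (by omega) m' hm' (θ - (-alpha) ^ (n + 2)) (by
        refine (abs_sub _ _).trans ?_
        rw [abs_pow, abs_neg, abs_of_pos ha]
        have : alpha ^ (n + 3) + alpha ^ (n + 2) = alpha ^ (n + 1) := by
          rw [pow_succ _ (n + 2), pow_succ _ (n + 1)]
          linear_combination alpha ^ (n + 1) * alpha_sq
        linarith)
      convert this using 4 with k _
      rw [← g_add_int (θ - (-alpha) ^ (n + 2) + alpha + k * alpha) (Nat.fib (n + 1))]
      congr 1
      push_cast
      linear_combination fib_succ_mul_alpha_sub (n + 1)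
    rw [Finset.sum_range_succ]
    linarith [hnn n]

/-- The first i scales form a geometric sum; each of the other j scales is cut at the truncation
height. -/
lemma sum_min_le (i j : ℕ) :
    ∑ r ∈ Finset.range (i + j), min (phi ^ i) (phi ^ (r + 3)) ≤ (j + 16) * phi ^ i := by
  have hp := phi_pos
  have h1 : ∀ n : ℕ, ∑ r ∈ Finset.range n, phi ^ (r + 3) ≤ 16 * phi ^ n := by
    intro n
    have h : ∀ n : ℕ, ∑ r ∈ Finset.range n, phi ^ (r + 3) = phi ^ (n + 4) - phi ^ 4 := by
      intro n
      induction n with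
      | zero => simp
      | succ n ih =>
        rw [Finset.sum_range_succ, ih]
        linear_combination (-phi ^ (n + 3)) * phi_sq
    rw [h, pow_add]
    have h4 : phi ^ 4 ≤ 2 ^ 4 := pow_le_pow_left₀ hp.le phi_lt_two.le 4
    nlinarith [pow_pos hp n, pow_pos hp 4]
  rw [Finset.sum_range_add]
  have h2 : ∑ r ∈ Finset.range i, min (phi ^ i) (phi ^ (r + 3)) ≤ 16 * phi ^ i :=
    (Finset.sum_le_sum fun r _ => min_le_right _ _).trans (h1 i)
  have h3 : ∑ r ∈ Finset.range j, min (phi ^ i) (phi ^ (i + r + 3)) ≤ j * phi ^ i := by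
    refine (Finset.sum_le_sum fun r _ => min_le_left _ _).trans ?_
    simp
  linarith

/-- The truncated Birkhoff sums at height `φ ^ i` are small compared with `φ ^ (i + j)`. -/
lemma abs_sum_clamp_Icc_le (i j m : ℕ) (hm : m < Nat.fib (i + j + 1)) :
    |∑ k ∈ Finset.Icc 1 m, clamp (phi ^ i) (g (k * alpha))| ≤ 4 * ((j + 16) * phi ^ i) := by
  have h := abs_sum_clamp_le_sum (pow_nonneg phi_pos.le i) (i + j) m hm 0
    (by simpa using (pow_pos alpha_pos _).le)
  have h2 : ∑ k ∈ Finset.Icc 1 m, clamp (phi ^ i) (g (k * alpha)) =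
      ∑ k ∈ Finset.range m, clamp (phi ^ i) (g (0 + alpha + k * alpha)) := by
    have h3 := Finset.sum_Ico_add' (fun k : ℕ => clamp (phi ^ i) (g (k * alpha))) 0 m 1
    rw [zero_add] at h3
    rw [Finset.range_eq_Ico, ← Finset.Ico_add_one_right_eq_Icc, ← h3]
    refine Finset.sum_congr rfl fun k _ => ?_
    congr 2
    push_cast
    ring
  rw [h2]
  linarith [sum_min_le i j]

/-! ### The excess as a finite lattice sum -/

/-- The part of `c` exceeding the truncation at height `M`. -/
noncomputable def excess (M c : ℝ) : ℝ := c - clamp M c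

lemma lt_abs_of_excess_ne_zero {M c : ℝ} (h : excess M c ≠ 0) : M < |c| := by
  by_contra! h'
  exact h (by rw [excess, clamp_of_abs_le h', sub_self])

lemma excess_mul {M c t : ℝ} (ht : 0 ≤ t) : excess (t * M) (t * c) = t * excess M c := by
  rw [excess, clamp_mul ht, excess, mul_sub]

lemma excess_neg {M c : ℝ} (hM : 0 ≤ M) : excess M (-c) = -excess M c := by
  rw [excess, clamp_neg hM, excess]; ring

/-- This joint continuity is what a sharp cutoff would lack: terms exactly at the threshold cause no
trouble. -/
lemma tendsto_excess {ι : Type*} {l : Filter ι} {M c : ι → ℝ} {M₀ c₀ : ℝ}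
    (hM : Tendsto M l (𝓝 M₀)) (hc : Tendsto c l (𝓝 c₀)) :
    Tendsto (fun i => excess (M i) (c i)) l (𝓝 (excess M₀ c₀)) :=
  hc.sub (hM.neg.max (hM.min hc))

/-- Half the side of `box j`. -/
noncomputable def radius (j : ℕ) : ℤ := ⌈2 * phi ^ j + 2⌉

/-- A finite set of lattice points carrying all terms of size at least `φ ^ (n - j)`. -/
noncomputable def box (j : ℕ) : Finset (ℤ × ℤ) :=
  Finset.Icc (-radius j) (radius j) ×ˢ Finset.Icc (-radius j) (radius j)

lemma mem_box {j : ℕ} {p : ℤ × ℤ} (h1 : |(p.1 : ℝ)| ≤ 1 + phi ^ j)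
    (hw : |elt p| ≤ phi ^ j) : p ∈ box j := by
  have hr : ∀ a : ℤ, |(a : ℝ)| ≤ 2 * phi ^ j + 2 → a ∈ Finset.Icc (-radius j) (radius j) := by
    intro a ha
    have : ((|a| : ℤ) : ℝ) ≤ radius j := by
      push_cast
      exact ha.trans (Int.le_ceil _)
    exact Finset.mem_Icc.2 (abs_le.1 (by exact_mod_cast this))
  have hp := pow_pos phi_pos j
  refine Finset.mem_product.2 ⟨hr _ (by linarith), hr _ ?_⟩
  have h2 : (p.2 : ℝ) = p.1 * alpha - elt p := by unfold elt; ring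
  rw [h2]
  refine (abs_sub _ _).trans ?_
  rw [abs_mul, abs_of_pos alpha_pos]
  nlinarith [mul_le_of_le_one_right (abs_nonneg (p.1 : ℝ)) alpha_lt_one.le]

/-- The contribution to `s_n(x)` of the points close to the singularity. -/
noncomputable def head (j n : ℕ) (x : ℝ) : ℝ :=
  (∑ p ∈ box j, if 1 ≤ kCoord n p ∧ kCoord n p ≤ ⌊(Nat.fib n : ℝ) * x⌋₊ then
    excess (phi ^ n * alpha ^ j) (g ((-alpha) ^ n * elt p)) else 0) / Nat.fib n

lemma g_coord (n : ℕ) (p : ℤ × ℤ) : g ((-alpha) ^ n * elt p) = g (kCoord n p * alpha) := by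
  rw [← kCoord_mul_alpha_sub, ← g_add_int _ (lCoord n p), sub_add_cancel]

/-- Below 1/2, `lCoord n p` is the integer nearest to `kCoord n p * alpha`, so the index k
determines p. -/
lemma elt_mul_lt_half (j : ℕ) :
    ∀ᶠ n : ℕ in atTop, ∀ p ∈ box j, |(-alpha) ^ n * elt p| < 1 / 2 := by
  refine (Finset.eventually_all _).2 fun p _ => ?_
  have h : Tendsto (fun n : ℕ => |(-alpha) ^ n * elt p|) atTop (𝓝 |0 * elt p|) := by
    refine ((tendsto_pow_atTop_nhds_zero_of_abs_lt_one ?_).mul_const _).abs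
    rw [abs_neg, abs_of_pos alpha_pos]
    exact alpha_lt_one
  rw [zero_mul, abs_zero] at h
  exact h.eventually_lt_const (by norm_num)

/-- Pair k with the nearest integer to k α and pass to lattice coordinates. A nonzero excess forces
|a α - b| < φ^j, and k ≤ q_n then bounds a, so the point lies in the box. -/
lemma sum_excess_eq (j : ℕ) : ∀ᶠ n : ℕ in atTop, ∀ m ≤ Nat.fib n,
    ∑ k ∈ Finset.Icc 1 m, excess (phi ^ n * alpha ^ j) (g (k * alpha)) =
      ∑ p ∈ box j, if 1 ≤ kCoord n p ∧ kCoord n p ≤ m then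
        excess (phi ^ n * alpha ^ j) (g ((-alpha) ^ n * elt p)) else 0 := by
  filter_upwards [elt_mul_lt_half j] with n hn m hm
  have hpn := pow_pos phi_pos n
  have han := pow_pos alpha_pos n
  have cast_k : ∀ p : ℤ × ℤ, 1 ≤ kCoord n p → ((kCoord n p).toNat : ℤ) = kCoord n p :=
    fun p hp => Int.toNat_of_nonneg (by omega)
  symm
  refine Finset.sum_bij_ne_zero (fun p _ _ => (kCoord n p).toNat) ?_ ?_ ?_ ?_
  · intro p _ h
    have h := (ite_ne_right_iff.1 h).1
    rw [Finset.mem_Icc]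
    omega
  · intro p hp h p' hp' h' hk
    have h := (ite_ne_right_iff.1 h).1
    have h' := (ite_ne_right_iff.1 h').1
    have hk : kCoord n p = kCoord n p' := by omega
    refine coord_injective n hk ?_
    have h1 := abs_lt.1 (hn p hp)
    have h2 := abs_lt.1 (hn p' hp')
    rw [← kCoord_mul_alpha_sub] at h1 h2
    rw [hk] at h1
    have h3 : |((lCoord n p - lCoord n p' : ℤ) : ℝ)| < 1 := by
      push_cast
      rw [abs_lt]
      constructor <;> linarith
    have h4 : |lCoord n p - lCoord n p'| < 1 := by exact_mod_cast h3
    have := Int.abs_lt_one_iff.1 h4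
    omega
  · intro k hk h
    obtain ⟨hk1, hkm⟩ := Finset.mem_Icc.1 hk
    obtain ⟨p, hpk, hpl⟩ := exists_coord n k (round ((k : ℝ) * alpha))
    have hz : (-alpha) ^ n * elt p = k * alpha - round ((k : ℝ) * alpha) := by
      rw [← kCoord_mul_alpha_sub, hpk, hpl, Int.cast_natCast]
    have hg : g ((-alpha) ^ n * elt p) = g (k * alpha) := by rw [hz, g_sub_round]
    have hp : p ∈ box j := by
      have hlt := lt_abs_of_excess_ne_zero h
      rw [← hg] at hlt
      have hz0 : (-alpha) ^ n * elt p ≠ 0 := by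
        intro h0
        rw [hz] at h0
        have := (int_combination_eq_zero (a := k) (b := -round ((k : ℝ) * alpha))
          (by push_cast; linarith)).1
        omega
      have hle := abs_g_le hz0 (by rw [hz]; exact abs_sub_round _)
      have hw : |elt p| < phi ^ j := by
        have h1 := hlt.trans_le hle
        rw [lt_div_iff₀ (abs_pos.2 hz0), abs_mul, abs_pow, abs_neg, abs_of_pos alpha_pos] at h1
        have h2 : phi ^ n * alpha ^ j * (alpha ^ n * |elt p|) = alpha ^ j * |elt p| := by
          linear_combination alpha ^ j * |elt p| * phi_pow_mul_alpha_pow n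
        have h3 := mul_lt_mul_of_pos_left (h2 ▸ h1) (pow_pos phi_pos j)
        rwa [← mul_assoc, phi_pow_mul_alpha_pow, one_mul, mul_one] at h3
      refine mem_box ?_ hw.le
      have h1 := kCoord_eq' n p
      rw [hpk, Int.cast_natCast] at h1
      have hF := fib_le_phi_pow n
      have hF0 : (0 : ℝ) ≤ Nat.fib n := Nat.cast_nonneg _
      have hkF : (k : ℝ) ≤ Nat.fib n := by exact_mod_cast hkm.trans hm
      have h2 : |(p.1 : ℝ)| * phi ^ n ≤ (1 + phi ^ j) * phi ^ n := by
        rw [← abs_of_pos hpn, ← abs_mul, abs_of_pos hpn,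
          show (p.1 : ℝ) * phi ^ n = k + Nat.fib n * elt p by linarith]
        refine (abs_add_le _ _).trans ?_
        rw [abs_mul, abs_of_nonneg hF0, abs_of_nonneg (Nat.cast_nonneg k)]
        nlinarith [abs_nonneg (elt p), pow_pos phi_pos j]
      exact le_of_mul_le_mul_right h2 hpn
    refine ⟨p, hp, ?_, by simp [hpk]⟩
    rw [if_pos (by omega), hg]
    exact h
  · intro p _ h
    have h := (ite_ne_right_iff.1 h).1
    rw [if_pos h, g_coord]
    congr 3
    rw [← Int.cast_natCast, cast_k p h.1]

/-- The uniform error made by keeping only the points close to the singularity. -/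
noncomputable def err (j : ℕ) : ℝ := 24 * ((j + 16) * alpha ^ j)

lemma tendsto_err : Tendsto err atTop (𝓝 0) := by
  have h1 : Tendsto (fun j : ℕ => (j : ℝ) * alpha ^ j) atTop (𝓝 0) :=
    tendsto_self_mul_const_pow_of_lt_one alpha_pos.le alpha_lt_one
  have h2 : Tendsto (fun j : ℕ => alpha ^ j) atTop (𝓝 0) :=
    tendsto_pow_atTop_nhds_zero_of_lt_one alpha_pos.le alpha_lt_one
  have := (h1.add (h2.const_mul 16)).const_mul 24
  simp only [mul_zero, add_zero] at this
  refine this.congr fun j => ?_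
  unfold err; ring

lemma abs_sFun_sub_head_le (j : ℕ) : ∀ᶠ n : ℕ in atTop, ∀ x ∈ Set.Icc (0 : ℝ) 1,
    |sFun n x - head j n x| ≤ err j := by
  filter_upwards [sum_excess_eq j, eventually_ge_atTop j, eventually_ge_atTop 2]
    with n hn hj h2 x hx
  obtain ⟨i, rfl⟩ := Nat.exists_eq_add_of_le' hj
  have hF : (0 : ℝ) < Nat.fib (i + j) := by exact_mod_cast Nat.fib_pos.2 (by omega)
  set m := ⌊(Nat.fib (i + j) : ℝ) * x⌋₊ with hm
  have hmF : m ≤ Nat.fib (i + j) := by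
    refine Nat.floor_le_of_le ?_
    exact mul_le_of_le_one_right hF.le hx.2
  have hM : phi ^ (i + j) * alpha ^ j = phi ^ i := by
    rw [pow_add, mul_assoc, phi_pow_mul_alpha_pow, mul_one]
  have hdiff : sFun (i + j) x - head j (i + j) x =
      (∑ k ∈ Finset.Icc 1 m, clamp (phi ^ i) (g (k * alpha))) / Nat.fib (i + j) := by
    rw [sFun, head, ← hm, ← hn m hmF, ← sub_div, S, ← Finset.sum_sub_distrib, hM]
    simp [excess]
  rw [hdiff, abs_div, abs_of_pos hF, div_le_iff₀ hF]
  refine (abs_sum_clamp_Icc_le i j m (hmF.trans_lt (Nat.fib_lt_fib_succ h2))).trans ?_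
  -- This 6 times the Denjoy–Koksma 4 is the 24 in `err`.
  have h6 : phi ^ (i + j) ≤ 6 * Nat.fib (i + j) := by
    obtain ⟨s, hs⟩ : ∃ s, i + j = s + 1 := ⟨i + j - 1, by omega⟩
    rw [hs, pow_succ]
    have := phi_pow_le_fib s
    nlinarith [phi_lt_two, phi_pos, pow_pos phi_pos s]
  rw [← hM, err]
  have h7 : (0 : ℝ) ≤ 4 * ((j + 16) * alpha ^ j) := by
    have := pow_pos alpha_pos j
    positivity
  have := mul_le_mul_of_nonneg_left h6 h7
  linarith

/-! ### Limits along a fixed parity -/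

/-- The limit of a term of `head`. -/
noncomputable def weight (j : ℕ) (w : ℝ) : ℝ :=
  excess (Real.sqrt 5 * alpha ^ j) (Real.sqrt 5 / (Real.pi * w))

lemma tendsto_g_mul_self : Tendsto (fun t => g t * t) (𝓝[≠] 0) (𝓝 (1 / Real.pi)) := by
  have hc : ContinuousAt
      (fun t : ℝ => Real.cos (Real.pi * t) / (Real.pi * Real.sinc (Real.pi * t))) 0 := by
    refine ContinuousAt.div (by fun_prop) ?_ (by simp)
    exact (continuous_const.mul (Real.continuous_sinc.comp (by fun_prop))).continuousAt
  have h := hc.tendsto.mono_left (nhdsWithin_le_nhds (s := {0}ᶜ))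
  simp only [mul_zero, Real.cos_zero, Real.sinc_zero, mul_one] at h
  refine h.congr' ?_
  filter_upwards [self_mem_nhdsWithin] with t ht
  have ht : t ≠ 0 := ht
  have hpt : Real.pi * t ≠ 0 := mul_ne_zero Real.pi_ne_zero ht
  rw [Real.sinc_of_ne_zero hpt, g, Real.cot_eq_cos_div_sin]
  have := Real.pi_ne_zero
  by_cases hs : Real.sin (Real.pi * t) = 0
  · simp [hs]
  · field_simp

lemma tendsto_fib_mul_alpha_pow :
    Tendsto (fun n : ℕ => (Nat.fib n : ℝ) * alpha ^ n) atTop (𝓝 (1 / Real.sqrt 5)) := by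
  have h5 : Real.sqrt 5 ≠ 0 := by positivity
  have h : Tendsto (fun n : ℕ => (1 - (-alpha * alpha) ^ n) / Real.sqrt 5) atTop
      (𝓝 ((1 - 0) / Real.sqrt 5)) := by
    refine (tendsto_const_nhds.sub (tendsto_pow_atTop_nhds_zero_of_abs_lt_one ?_)).div_const _
    rw [abs_mul, abs_neg, abs_of_pos alpha_pos]
    nlinarith [alpha_pos, alpha_lt_one]
  rw [sub_zero] at h
  refine h.congr fun n => ?_
  rw [div_eq_iff h5, mul_pow]
  linear_combination (-alpha ^ n) * sqrt_five_mul_fib n - phi_pow_mul_alpha_pow n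

lemma tendsto_phi_pow_div_fib :
    Tendsto (fun n : ℕ => phi ^ n / (Nat.fib n : ℝ)) atTop (𝓝 (Real.sqrt 5)) := by
  have h := tendsto_fib_mul_alpha_pow.inv₀ (by positivity)
  rw [one_div, inv_inv] at h
  refine h.congr fun n => ?_
  rw [mul_inv, ← inv_phi_pow, inv_inv]; ring

/-- Homogeneity moves the division by q_n inside the excess, where height and value converge
separately. -/
lemma tendsto_excess_div_fib {u : ℕ → ℕ} (hu : Tendsto u atTop atTop) {σ : ℝ} (hσ : σ ≠ 0)
    (hsign : ∀ n, (-1 : ℝ) ^ u n = σ) (j : ℕ) (p : ℤ × ℤ) :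
    Tendsto (fun n => excess (phi ^ u n * alpha ^ j) (g ((-alpha) ^ u n * elt p)) /
      Nat.fib (u n)) atTop (𝓝 (weight j (σ * elt p))) := by
  have hpow : ∀ n, (-alpha) ^ u n = σ * alpha ^ u n := fun n => by
    rw [← hsign n, ← mul_pow, neg_one_mul]
  have hM : Tendsto (fun n => phi ^ u n / (Nat.fib (u n) : ℝ) * alpha ^ j) atTop
      (𝓝 (Real.sqrt 5 * alpha ^ j)) := (tendsto_phi_pow_div_fib.comp hu).mul_const _
  have hc : Tendsto (fun n => g ((-alpha) ^ u n * elt p) / (Nat.fib (u n) : ℝ)) atTop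
      (𝓝 (Real.sqrt 5 / (Real.pi * (σ * elt p)))) := by
    -- Both sides are then the default value 0 of a division by zero.
    by_cases hw : elt p = 0
    · simp [hw, g, Real.cot_eq_cos_div_sin]
    have hne : ∀ n, (-alpha) ^ u n * elt p ≠ 0 := fun n =>
      mul_ne_zero (pow_ne_zero _ (neg_ne_zero.2 alpha_pos.ne')) hw
    have ht : Tendsto (fun n => (-alpha) ^ u n * elt p) atTop (𝓝[≠] 0) := by
      refine tendsto_nhdsWithin_iff.2 ⟨?_, Eventually.of_forall hne⟩
      have : Tendsto (fun n : ℕ => (-alpha) ^ n) atTop (𝓝 0) := by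
        refine tendsto_pow_atTop_nhds_zero_of_abs_lt_one ?_
        rw [abs_neg, abs_of_pos alpha_pos]
        exact alpha_lt_one
      simpa using (this.comp hu).mul_const (elt p)
    have h1 := tendsto_g_mul_self.comp ht
    have h2 := ((tendsto_fib_mul_alpha_pow.comp hu).const_mul (σ * elt p)).inv₀
      (mul_ne_zero (mul_ne_zero hσ hw) (by positivity))
    have h3 := h1.mul h2
    have heq : 1 / Real.pi * (σ * elt p * (1 / Real.sqrt 5))⁻¹ =
        Real.sqrt 5 / (Real.pi * (σ * elt p)) := by
      have : Real.sqrt 5 ≠ 0 := by positivity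
      have := Real.pi_ne_zero
      field_simp
    rw [heq] at h3
    refine h3.congr fun n => ?_
    have h4 : σ * elt p * ((Nat.fib (u n) : ℝ) * alpha ^ u n) =
        Nat.fib (u n) * ((-alpha) ^ u n * elt p) := by rw [hpow]; ring
    simp only [Function.comp]
    rw [h4, mul_inv, mul_comm (Nat.fib (u n) : ℝ)⁻¹, ← mul_assoc,
      mul_inv_cancel_right₀ (hne n), div_eq_mul_inv]
  refine (tendsto_excess hM hc).congr fun n => ?_
  have := excess_mul (M := phi ^ u n * alpha ^ j) (c := g ((-alpha) ^ u n * elt p))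
    (t := (Nat.fib (u n) : ℝ)⁻¹) (by positivity)
  rw [div_eq_inv_mul (excess _ _), ← this]
  congr 1 <;> ring

lemma tendsto_fib_atTop : Tendsto (fun n : ℕ => (Nat.fib n : ℝ)) atTop atTop := by
  refine tendsto_atTop_mono' atTop (f₁ := fun n : ℕ => phi ^ n / 6) ?_
    ((tendsto_pow_atTop_atTop_of_one_lt one_lt_phi).atTop_div_const (by norm_num))
  filter_upwards [eventually_ge_atTop 1] with n hn
  obtain ⟨s, rfl⟩ := Nat.exists_eq_add_of_le' hn
  have := phi_pow_le_fib s
  rw [pow_succ]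
  nlinarith [phi_lt_two, phi_pos, pow_pos phi_pos s]

/-- The main term q_n `conj p` decides strict inequalities, its error being at most |p.1|. In the
tie `conj p = x` the sign of the error decides; `conj p = 0` forces p = 0 by irrationality. -/
lemma eventually_coord_iff {u : ℕ → ℕ} (hu : Tendsto u atTop atTop) {σ : ℝ}
    (hsign : ∀ n, (-1 : ℝ) ^ u n = σ) (p : ℤ × ℤ) {x : ℝ} (hx : 0 ≤ x) :
    ∀ᶠ n in atTop, (1 ≤ kCoord (u n) p ∧
      kCoord (u n) p ≤ (⌊(Nat.fib (u n) : ℝ) * x⌋₊ : ℤ)) ↔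
      (0 < conj p ∧ (conj p < x ∨ (conj p = x ∧ σ * p.1 ≤ 0))) := by
  have hlarge : ∀ c : ℝ, 0 < c → ∀ᶠ n in atTop, |(p.1 : ℝ)| + 1 < Nat.fib (u n) * c :=
    fun c hc => ((tendsto_fib_atTop.comp hu).atTop_mul_const hc).eventually_gt_atTop _
  have hk : ∀ n, (kCoord (u n) p : ℝ) = Nat.fib (u n) * conj p + σ * p.1 * alpha ^ u n := by
    intro n
    rw [kCoord_eq, ← hsign n, neg_pow]; ring
  have hσ : |σ| = 1 := by rw [← hsign 0, abs_pow, abs_neg, abs_one, one_pow]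
  have hb : ∀ n, |σ * p.1 * alpha ^ u n| ≤ |(p.1 : ℝ)| := fun n => by
    have ha := pow_pos alpha_pos (u n)
    rw [abs_mul, abs_mul, hσ, one_mul, abs_of_pos ha]
    exact mul_le_of_le_one_right (abs_nonneg _) (pow_le_one₀ alpha_pos.le alpha_lt_one.le)
  have hfl : ∀ n, kCoord (u n) p ≤ (⌊(Nat.fib (u n) : ℝ) * x⌋₊ : ℤ) ↔
      (kCoord (u n) p : ℝ) ≤ Nat.fib (u n) * x := fun n => by
    rw [Int.natCast_floor_eq_floor (by positivity), Int.le_floor]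
  rcases lt_trichotomy (conj p) 0 with hc | hc | hc
  · filter_upwards [hlarge (-conj p) (by linarith)] with n hn
    refine iff_of_false (fun h => ?_) (fun h => by linarith [h.1])
    have h1 : (1 : ℝ) ≤ kCoord (u n) p := by exact_mod_cast h.1
    have := abs_le.1 (hb n)
    rw [hk] at h1
    linarith
  · have h0 := int_combination_eq_zero (a := p.1) (b := p.1 + p.2) (by
      push_cast; rw [← hc]; unfold conj phi; ring)
    refine Eventually.of_forall fun n => iff_of_false (fun h => ?_) (fun h => by linarith [h.1])
    have h2 : p.2 = 0 := by omega
    have : kCoord (u n) p = 0 := by simp [kCoord, h0.1, h2]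
    omega
  · have h1 : ∀ᶠ n in atTop, 1 ≤ kCoord (u n) p := by
      filter_upwards [hlarge _ hc] with n hn
      have := abs_le.1 (hb n)
      have h1 : (1 : ℝ) ≤ kCoord (u n) p := by rw [hk]; linarith
      exact_mod_cast h1
    rcases lt_trichotomy (conj p) x with h | h | h
    · filter_upwards [h1, hlarge (x - conj p) (by linarith)] with n hn hn'
      refine iff_of_true ⟨hn, (hfl n).2 ?_⟩ ⟨hc, Or.inl h⟩
      have := abs_le.1 (hb n)
      rw [hk]
      linarith
    · filter_upwards [h1] with n hn
      have ha := pow_pos alpha_pos (u n)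
      rw [hfl, hk, h]
      have : (Nat.fib (u n) * x + σ * p.1 * alpha ^ u n ≤ Nat.fib (u n) * x) ↔ σ * p.1 ≤ 0 := by
        rw [add_le_iff_nonpos_right]
        exact ⟨fun h => by by_contra! h'; exact absurd h (not_le.2 (mul_pos h' ha)),
          fun h => mul_nonpos_of_nonpos_of_nonneg h ha.le⟩
      rw [this]
      have hx' : 0 < x := h ▸ hc
      simp [hn, hx']
    · filter_upwards [hlarge (conj p - x) (by linarith)] with n hn
      refine iff_of_false (fun h' => ?_) (fun h' => by rcases h'.2 with h2 | h2 <;> linarith [h2])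
      have h2 := (hfl n).1 h'.2
      have := abs_le.1 (hb n)
      rw [hk] at h2
      linarith

open Classical in
/-- The limit of `head j n x` as `n → ∞` with `(-1) ^ n = σ`. -/
noncomputable def headLimit (σ : ℝ) (j : ℕ) (x : ℝ) : ℝ :=
  ∑ p ∈ box j, if 0 < conj p ∧ (conj p < x ∨ (conj p = x ∧ σ * p.1 ≤ 0)) then
    weight j (σ * elt p) else 0

lemma tendsto_head {u : ℕ → ℕ} (hu : Tendsto u atTop atTop) {σ : ℝ} (hσ : σ ≠ 0)
    (hsign : ∀ n, (-1 : ℝ) ^ u n = σ) (j : ℕ) {x : ℝ} (hx : 0 ≤ x) :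
    Tendsto (fun n => head j (u n) x) atTop (𝓝 (headLimit σ j x)) := by
  classical
  unfold head headLimit
  simp only [Finset.sum_div]
  refine tendsto_finsetSum _ fun p _ => ?_
  by_cases h : 0 < conj p ∧ (conj p < x ∨ (conj p = x ∧ σ * p.1 ≤ 0))
  · rw [if_pos h]
    refine (tendsto_excess_div_fib hu hσ hsign j p).congr' ?_
    filter_upwards [eventually_coord_iff hu hsign p hx] with n hn
    rw [if_pos (hn.2 h)]
  · rw [if_neg h]
    refine tendsto_const_nhds.congr' ?_
    filter_upwards [eventually_coord_iff hu hsign p hx] with n hn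
    rw [if_neg (fun h' => h (hn.1 h')), zero_div]

/-- Interchange of limits under a uniform approximation. -/
lemma exists_tendsto_of_approx {ι : Type*} {l : Filter ι} [l.NeBot] {a : ι → ℝ}
    {b : ℕ → ι → ℝ} {B e : ℕ → ℝ} (hb : ∀ j, Tendsto (b j) l (𝓝 (B j)))
    (he : Tendsto e atTop (𝓝 0)) (hab : ∀ j, ∀ᶠ i in l, |a i - b j i| ≤ e j) :
    ∃ L, Tendsto a l (𝓝 L) ∧ ∀ j, |L - B j| ≤ e j := by
  have hcau : Cauchy (map a l) := by
    refine Metric.cauchy_iff.2 ⟨inferInstance, fun ε hε => ?_⟩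
    obtain ⟨j, hj⟩ := (he.eventually_lt_const (by positivity : 0 < ε / 4)).exists
    refine ⟨Metric.ball (B j) (ε / 2), ?_, fun y hy z hz => ?_⟩
    · refine mem_map.2 ?_
      filter_upwards [hab j, (hb j).eventually (Metric.ball_mem_nhds _ (by positivity : 0 < ε / 4))]
        with i h1 h2
      rw [Real.dist_eq] at h2
      change a i ∈ Metric.ball (B j) (ε / 2)
      rw [Metric.mem_ball, Real.dist_eq]
      linarith [abs_sub_le (a i) (b j i) (B j)]
    · linarith [dist_triangle_right y z (B j), Metric.mem_ball.1 hy, Metric.mem_ball.1 hz]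
  obtain ⟨L, hL⟩ := CompleteSpace.complete hcau
  exact ⟨L, hL, fun j => le_of_tendsto ((Tendsto.sub hL (hb j)).abs) (hab j)⟩

lemma exists_limit {u : ℕ → ℕ} (hu : Tendsto u atTop atTop) {σ : ℝ} (hσ : σ ≠ 0)
    (hsign : ∀ n, (-1 : ℝ) ^ u n = σ) {x : ℝ} (hx : x ∈ Set.Icc (0 : ℝ) 1) :
    ∃ L, Tendsto (fun n => sFun (u n) x) atTop (𝓝 L) ∧ ∀ j, |L - headLimit σ j x| ≤ err j :=
  exists_tendsto_of_approx (fun j => tendsto_head hu hσ hsign j hx.1) tendsto_err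
    fun j => (hu.eventually (abs_sFun_sub_head_le j)).mono fun _ h => h x hx

/-! ### Right-continuous version and self-similarity -/

open Classical in
/-- The truncated golden graph. -/
noncomputable def headRight (j : ℕ) (x : ℝ) : ℝ :=
  ∑' p : ℤ × ℤ, if 0 < conj p ∧ conj p ≤ x then weight j (elt p) else 0

lemma abs_elt_le_of_weight_ne_zero {j : ℕ} {w : ℝ} (h : weight j w ≠ 0) : |w| ≤ phi ^ j := by
  have h1 := lt_abs_of_excess_ne_zero h
  have hpi := Real.pi_gt_three
  have h5 : 0 < Real.sqrt 5 := by positivity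
  have ha := pow_pos alpha_pos j
  by_cases hw : w = 0
  · simp [hw, (pow_pos phi_pos j).le]
  have hw' := abs_pos.2 hw
  rw [abs_div, abs_mul, abs_of_pos h5, abs_of_pos Real.pi_pos, lt_div_iff₀ (by positivity),
    mul_assoc, mul_lt_iff_lt_one_right h5] at h1
  have h2 : alpha ^ j * |w| ≤ 1 := by
    nlinarith [mul_pos ha hw']
  have h3 := mul_le_mul_of_nonneg_left h2 (pow_pos phi_pos j).le
  rwa [← mul_assoc, phi_pow_mul_alpha_pow, one_mul, mul_one] at h3

-- The sum over the whole lattice is suited to reindexing by the unit, which does not preserve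
-- boxes. It is finite because √5 a = `elt p + conj p` and both summands are bounded on the support.
open Classical in
lemma headRight_eq_sum (j : ℕ) {x : ℝ} (hx : x ≤ 1) :
    headRight j x =
      ∑ p ∈ box j, if 0 < conj p ∧ conj p ≤ x then weight j (elt p) else 0 := by
  refine tsum_eq_sum fun p hp => ?_
  by_contra h
  obtain ⟨⟨h1, h2⟩, h3⟩ := ite_ne_right_iff.1 h
  have hw := abs_elt_le_of_weight_ne_zero h3
  refine hp (mem_box ?_ hw)
  have h5 : 1 ≤ Real.sqrt 5 := by
    rw [Real.one_le_sqrt]; norm_num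
  have h4 : |(p.1 : ℝ)| ≤ |Real.sqrt 5 * p.1| := by
    rw [abs_mul, abs_of_nonneg (zero_le_one.trans h5)]
    exact le_mul_of_one_le_left (abs_nonneg _) h5
  rw [sqrt_five_mul_fst] at h4
  have := abs_add_le (elt p) (conj p)
  rw [abs_of_pos h1] at this
  linarith

/-- Multiplication by `-φ`, the conjugate of multiplication by `α`, in coordinates. -/
def scaleEquiv : ℤ × ℤ ≃ ℤ × ℤ where
  toFun p := (p.2, p.1 - p.2)
  invFun p := (p.1 + p.2, p.1)
  left_inv p := by ext <;> simp
  right_inv p := by ext <;> simp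

lemma conj_scaleEquiv (p : ℤ × ℤ) : conj (scaleEquiv p) = alpha * conj p := by
  simp only [conj, scaleEquiv, Equiv.coe_fn_mk, phi]
  push_cast
  linear_combination (-(p.1 : ℝ)) * alpha_sq

lemma elt_scaleEquiv (p : ℤ × ℤ) : elt (scaleEquiv p) = -(phi * elt p) := by
  simp only [elt, scaleEquiv, Equiv.coe_fn_mk, phi]
  push_cast
  linear_combination (p.1 : ℝ) * alpha_sq

/-- Scaling the value by α must scale the height by α too, hence the passage from j to j + 1. -/
lemma weight_neg_phi_mul (j : ℕ) (w : ℝ) :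
    weight (j + 1) (-(phi * w)) = -alpha * weight j w := by
  have h1 : Real.sqrt 5 / (Real.pi * -(phi * w)) = -(alpha * (Real.sqrt 5 / (Real.pi * w))) := by
    rw [← inv_phi_pow 1 |>.trans (pow_one alpha), pow_one, mul_neg, div_neg, ← mul_assoc,
      mul_comm Real.pi, mul_assoc, mul_comm phi, ← div_div, div_eq_inv_mul _ phi]
  have ha := alpha_pos
  rw [weight, weight, h1, excess_neg (by positivity), pow_succ,
    show Real.sqrt 5 * (alpha ^ j * alpha) = alpha * (Real.sqrt 5 * alpha ^ j) by ring,
    excess_mul ha.le, neg_mul]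

lemma headRight_alpha_mul (j : ℕ) (x : ℝ) :
    headRight (j + 1) (alpha * x) = -alpha * headRight j x := by
  classical
  rw [headRight, headRight, ← tsum_mul_left, ← scaleEquiv.tsum_eq]
  refine tsum_congr fun p => ?_
  rw [conj_scaleEquiv, elt_scaleEquiv, weight_neg_phi_mul, mul_ite, mul_zero]
  congr 1
  rw [mul_pos_iff_of_pos_left alpha_pos, mul_le_mul_iff_right₀ alpha_pos]

/-- The two sums can differ only at p with `conj p = x` and p.1 ≥ 1, and then x = (p.1 + p.2) + p.1
α. -/
lemma headLimit_one_eq_headRight (j : ℕ) {x : ℝ} (hx : x ≤ 1)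
    (h : ∀ a b : ℤ, 1 ≤ b → x ≠ a + b * alpha) : headLimit 1 j x = headRight j x := by
  rw [headRight_eq_sum j hx, headLimit]
  refine Finset.sum_congr rfl fun p _ => ?_
  rw [one_mul, one_mul]
  congr 1
  refine propext (and_congr_right fun _ => ?_)
  rw [le_iff_lt_or_eq (a := conj p)]
  refine or_congr_right ⟨fun h' => h'.1, fun h' => ⟨h', ?_⟩⟩
  by_contra! hp
  refine h (p.1 + p.2) p.1 (by exact_mod_cast hp) ?_
  rw [← h', conj, phi]
  push_cast
  ring

lemma eventually_conj_iff (p : ℤ × ℤ) (x : ℝ) :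
    ∀ᶠ y in 𝓝[>] x, (conj p ≤ x ↔ conj p < y) ∧ (conj p ≤ x ↔ conj p ≤ y) := by
  rcases le_or_gt (conj p) x with h | h
  · filter_upwards [self_mem_nhdsWithin] with y hy
    have hy : x < y := hy
    exact ⟨iff_of_true h (h.trans_lt hy), iff_of_true h (h.trans hy.le)⟩
  · filter_upwards [nhdsWithin_le_nhds (gt_mem_nhds h)] with y hy
    exact ⟨iff_of_false (not_le.2 h) (not_lt.2 (le_of_lt hy)),
      iff_of_false (not_le.2 h) (not_le.2 hy)⟩

lemma eventually_mem_Icc {x : ℝ} (hx : x ∈ Set.Ico (0 : ℝ) 1) :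
    ∀ᶠ y in 𝓝[>] x, y ∈ Set.Icc (0 : ℝ) 1 := by
  filter_upwards [self_mem_nhdsWithin, nhdsWithin_le_nhds (gt_mem_nhds hx.2)] with y hy hy'
  exact ⟨hx.1.trans (le_of_lt hy), le_of_lt hy'⟩

/-- Only finitely many jumps occur, so the truncated function is constant just to the right of x. -/
lemma tendsto_headLimit (j : ℕ) {x : ℝ} (hx : x ∈ Set.Ico (0 : ℝ) 1) :
    Tendsto (headLimit 1 j) (𝓝[>] x) (𝓝 (headRight j x)) := by
  refine tendsto_const_nhds.congr' ?_
  have h := (Finset.eventually_all (box j)).2 fun p _ => eventually_conj_iff p x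
  filter_upwards [h] with y hy
  rw [headRight_eq_sum j hx.2.le, headLimit]
  refine Finset.sum_congr rfl fun p hp => ?_
  rw [one_mul, one_mul]
  congr 1
  refine propext (and_congr_right fun _ => ?_)
  obtain ⟨h1, h2⟩ := hy p hp
  have := h1.symm.trans h2
  constructor
  · exact fun h => Or.inl (h1.1 h)
  · rintro (h | h)
    · exact h1.2 h
    · exact h2.2 h.1.le

lemma tendsto_headRight (j : ℕ) {x : ℝ} (hx : x ∈ Set.Ico (0 : ℝ) 1) :
    Tendsto (headRight j) (𝓝[>] x) (𝓝 (headRight j x)) := by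
  refine tendsto_const_nhds.congr' ?_
  have h := (Finset.eventually_all (box j)).2 fun p _ => eventually_conj_iff p x
  filter_upwards [h, eventually_mem_Icc hx] with y hy hy1
  rw [headRight_eq_sum j hx.2.le, headRight_eq_sum j hy1.2]
  refine Finset.sum_congr rfl fun p hp => ?_
  simp only [(hy p hp).2]

lemma eq_of_abs_sub_le {a b : ℝ} {B : ℕ → ℝ} (ha : ∀ j, |a - B j| ≤ err j)
    (hb : ∀ j, |b - B j| ≤ err j) : a = b := by
  have h : Tendsto (fun j => err j + err j) atTop (𝓝 0) := by
    simpa using tendsto_err.add tendsto_err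
  have h0 : |a - b| ≤ 0 := ge_of_tendsto' h fun j => by
    have := abs_sub_le a (B j) b
    rw [abs_sub_comm (B j) b] at this
    linarith [ha j, hb j]
  linarith [abs_nonpos_iff.1 h0]

lemma tendsto_of_abs_sub_le {a : ℝ} {B : ℕ → ℝ} (ha : ∀ j, |a - B j| ≤ err j) :
    Tendsto B atTop (𝓝 a) :=
  tendsto_iff_dist_tendsto_zero.2 <| squeeze_zero (fun _ => dist_nonneg)
    (fun j => by rw [Real.dist_eq, abs_sub_comm]; exact ha j) tendsto_err

/-- The right-continuous version of the even limit. -/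
lemma exists_golden_graph {sEven : ℝ → ℝ}
    (hE : ∀ x ∈ Set.Icc (0 : ℝ) 1, ∀ j, |sEven x - headLimit 1 j x| ≤ err j) :
    ∃ s : ℝ → ℝ,
      (∀ x ∈ Set.Icc (0 : ℝ) 1, ∀ j, |s x - headRight j x| ≤ err j) ∧
      (∀ x ∈ Set.Ico (0 : ℝ) 1, Tendsto sEven (𝓝[>] x) (𝓝 (s x))) := by
  have h : ∀ x : ℝ, ∃ L : ℝ, (x ∈ Set.Icc (0 : ℝ) 1 → ∀ j, |L - headRight j x| ≤ err j) ∧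
      (x ∈ Set.Ico (0 : ℝ) 1 → Tendsto sEven (𝓝[>] x) (𝓝 L)) := by
    intro x
    by_cases hx : x ∈ Set.Ico (0 : ℝ) 1
    · obtain ⟨L, h1, h2⟩ := exists_tendsto_of_approx (fun j => tendsto_headLimit j hx) tendsto_err
        fun j => (eventually_mem_Icc hx).mono fun y hy => hE y hy j
      exact ⟨L, fun _ => h2, fun _ => h1⟩
    · refine ⟨sEven x, fun hx' j => ?_, fun h => absurd h hx⟩
      -- The endpoint 1 is not exceptional, so the even limit itself serves there.
      have hx1 : x = 1 := le_antisymm hx'.2 (by by_contra! h; exact hx ⟨hx'.1, h⟩)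
      rw [← headLimit_one_eq_headRight j hx'.2]
      · exact hE x hx' j
      · intro a b hb hab
        rw [hx1] at hab
        have := (int_combination_eq_zero (a := b) (b := a - 1) (by push_cast; linarith)).1
        omega
  choose s h1 h2 using h
  exact ⟨s, h1, h2⟩

end GoldenGraph

theorem theorem1 :
    ∃ sEven sOdd s : ℝ → ℝ,
      -- pointwise convergence on `[0,1]` along the even and along the odd subsequence
      (∀ x ∈ Set.Icc (0 : ℝ) 1,
        Tendsto (fun n : ℕ => GoldenGraph.sFun (2 * n) x) atTop (𝓝 (sEven x))) ∧
      (∀ x ∈ Set.Icc (0 : ℝ) 1,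
        Tendsto (fun n : ℕ => GoldenGraph.sFun (2 * n + 1) x) atTop (𝓝 (sOdd x))) ∧
      -- `s` is the even limit, except at the points `a + b α` with `b ≥ 1`
      (∀ x ∈ Set.Icc (0 : ℝ) 1,
        (∀ a b : ℤ, 1 ≤ b → x ≠ (a : ℝ) + (b : ℝ) * GoldenGraph.alpha) → s x = sEven x) ∧
      -- everywhere on `[0,1)`, `s` is the limit from the right of the even limit
      (∀ x ∈ Set.Ico (0 : ℝ) 1, Tendsto sEven (𝓝[>] x) (𝓝 (s x))) ∧
      -- `s` is continuous from the right
      (∀ x ∈ Set.Ico (0 : ℝ) 1, ContinuousWithinAt s (Set.Ici x) x) ∧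
      -- `s` is self-similar
      (∀ x ∈ Set.Icc (0 : ℝ) 1, s (GoldenGraph.alpha * x) = - GoldenGraph.alpha * s x) := by
  open GoldenGraph in
  have hu0 : Tendsto (fun n : ℕ => 2 * n) atTop atTop :=
    tendsto_atTop_mono (fun n => by rw [id]; omega) tendsto_id
  have hu1 : Tendsto (fun n : ℕ => 2 * n + 1) atTop atTop :=
    tendsto_atTop_mono (fun n => by rw [id]; omega) tendsto_id
  have heven : ∀ x : ℝ, ∃ L : ℝ, x ∈ Set.Icc (0 : ℝ) 1 →
      Tendsto (fun n : ℕ => sFun (2 * n) x) atTop (𝓝 L) ∧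
        ∀ j, |L - headLimit 1 j x| ≤ err j := fun x => by
    by_cases hx : x ∈ Set.Icc (0 : ℝ) 1
    · obtain ⟨L, hL⟩ := exists_limit hu0 (σ := 1) (by norm_num) (fun n => by simp) hx
      exact ⟨L, fun _ => hL⟩
    · exact ⟨0, fun h => absurd h hx⟩
  have hodd : ∀ x : ℝ, ∃ L : ℝ, x ∈ Set.Icc (0 : ℝ) 1 →
      Tendsto (fun n : ℕ => sFun (2 * n + 1) x) atTop (𝓝 L) := fun x => by
    by_cases hx : x ∈ Set.Icc (0 : ℝ) 1
    · obtain ⟨L, hL, -⟩ := exists_limit hu1 (σ := -1) (by norm_num)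
        (fun n => by simp [pow_succ]) hx
      exact ⟨L, fun _ => hL⟩
    · exact ⟨0, fun h => absurd h hx⟩
  choose sEven hEven using heven
  choose sOdd hOdd using hodd
  obtain ⟨s, hs, hright⟩ := exists_golden_graph (sEven := sEven) fun x hx => (hEven x hx).2
  refine ⟨sEven, sOdd, s, fun x hx => (hEven x hx).1, hOdd, fun x hx hne => ?_, hright,
    fun x hx => ?_, fun x hx => ?_⟩
  · refine eq_of_abs_sub_le (hs x hx) fun j => ?_
    rw [← headLimit_one_eq_headRight j hx.2 hne]
    exact (hEven x hx).2 j
  · obtain ⟨L, hL, hLj⟩ := exists_tendsto_of_approx (fun j => tendsto_headRight j hx) tendsto_err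
      fun j => (eventually_mem_Icc hx).mono fun y hy => hs y hy j
    rw [← continuousWithinAt_Ioi_iff_Ici]
    rwa [eq_of_abs_sub_le hLj (hs x ⟨hx.1, hx.2.le⟩)] at hL
  · have ha := alpha_pos
    have hax : alpha * x ∈ Set.Icc (0 : ℝ) 1 :=
      ⟨mul_nonneg ha.le hx.1, mul_le_one₀ alpha_lt_one.le hx.1 hx.2⟩
    -- Level j + 1 at α x is matched with level j at x, as the scaling identity demands.
    have h1 := (tendsto_of_abs_sub_le (hs _ hax)).comp (tendsto_add_atTop_nat 1)
    have h2 := (tendsto_of_abs_sub_le (hs _ hx)).const_mul (-alpha)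
    refine tendsto_nhds_unique h1 (h2.congr fun j => ?_)
    exact (headRight_alpha_mul j x).symm
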